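/- Call a nonincreasing sequence $\pi=(d_1,\dots,d_n)$ of nonnegative integers graphic if it is the degree sequence of a finite simple graph on $n$ vertices; such a graph is a realization of $\pi$. Write $\sigma(\pi)=d_1+\cdots+d_n$. For a graph $H$, let $\sigma(H,n)$ be the smallest even integer $l$ such that every $n$-term graphic sequence $\pi$ with all terms positive and $\sigma(\pi)\ge l$ has a realization containing $H$ as a subgraph. Let $K_{3,1,1}$ be the complete tripartite graph with parts of sizes $3,1,1$. Theorem 4.4. For $n=5$ and for every $n\ge 7$, $$\sigma(K_{3,1,1},n)=4n-2.$$ For $n=6$, if $\pi$ is a $6$-term graphic sequence with $\sigma(\pi)\ge 22$, then either $\pi$ has a realization containing $K_{3,1,1}$ as a subgraph or $\pi=(4,4,4,4,4,4)$. Moreover, $\sigma(K_{3,1,1},6)=26$. -/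

import Mathlib

/-- `G` is a realization of the sequence `d = (d 0, …, d (n-1))`: a simple graph of order `n` whose
degree sequence is `d`, the vertices being labelled by the positions in the sequence. -/
def IsRealization {n : ℕ} (G : SimpleGraph (Fin n)) (d : Fin n → ℕ) : Prop :=
  ∀ i, (G.neighborSet i).ncard = d i

/-- `d` is an `n`-term graphic sequence: a nonincreasing sequence of nonnegative integers which is
the degree sequence of a simple graph of order `n`. -/
def IsGraphic {n : ℕ} (d : Fin n → ℕ) : Prop :=
  Antitone d ∧ ∃ G : SimpleGraph (Fin n), IsRealization G d

/-- `d` has a realization that contains `H` as a (not necessarily induced) subgraph. -/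
def HasRealizationContaining {V : Type*} (H : SimpleGraph V) {n : ℕ} (d : Fin n → ℕ) : Prop :=
  ∃ G : SimpleGraph (Fin n), IsRealization G d ∧ H.IsContained G

/-- The even `l` such that every `n`-term positive graphic sequence with sum at least `l` has a
realization containing `H`. -/
def sigmaSet {V : Type*} (H : SimpleGraph V) (n : ℕ) : Set ℕ :=
  {l | Even l ∧ ∀ d : Fin n → ℕ, IsGraphic d → (∀ i, 0 < d i) → l ≤ ∑ i, d i →
    HasRealizationContaining H d}

/-- `σ(H, n)`: the smallest even `l` such that every `n`-term positive graphic sequence with sum at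
least `l` has a realization containing `H`. -/
noncomputable def sigma {V : Type*} (H : SimpleGraph V) (n : ℕ) : ℕ :=
  sInf (sigmaSet H n)

/-- The minimum defining `σ(H, n)` is always attained, so `sigma` never takes a junk value. -/
theorem sigma_isLeast {V : Type*} (H : SimpleGraph V) (n : ℕ) :
    IsLeast (sigmaSet H n) (sigma H n) := by
  have hne : (sigmaSet H n).Nonempty := by
    refine ⟨2 * (n * n + 1), even_two_mul _, ?_⟩
    rintro d ⟨-, G, hG⟩ - hsum
    exfalso
    have hle : ∑ i, d i ≤ ∑ _i : Fin n, n := by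
      refine Finset.sum_le_sum fun i _ => ?_
      rw [← hG i]
      simpa [Set.ncard_univ] using Set.ncard_le_ncard (Set.subset_univ (G.neighborSet i))
    simp only [Finset.sum_const, Finset.card_univ, Fintype.card_fin, smul_eq_mul] at hle
    omega
  exact ⟨Nat.sInf_mem hne, fun _ hl => Nat.sInf_le hl⟩

/-- The complete tripartite graph `K_{3,1,1}`, with parts of sizes 3, 1 and 1. -/
def K311 : SimpleGraph (Σ i : Fin 3, Fin (![3, 1, 1] i)) :=
  SimpleGraph.completeMultipartiteGraph fun i : Fin 3 => Fin (![3, 1, 1] i)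

/-! A copy of $K_{3,1,1}$ is a book: an edge, the spine, with three common neighbours, the pages.
The upper bound is `exists_vdeg_eq_hasBook`, an induction on the size of a set $S$ carrying all
edges. The vertex type stays fixed: a vertex is deleted by isolating it and shrinking $S$.

Let $u$ have minimum degree in $S$. If deleting $u$ keeps the degree sum above the smaller
threshold, a book found in the rest survives when the star of $u$ is put back. The exception is a
4-regular remainder on six vertices (the octahedron), where one switch creates a book. Otherwise $u$
has degree 3 or 4. A vertex adjacent to all the others yields a book at once, so assume there is
none. If the degree is 4, the graph is 4-regular and is replaced by an explicit regular graph with a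
book. If it is 3, the degree sum equals the threshold. Orders 6 and 7 leave four sequences, realized
explicitly. From order 8 on, $u$ is replaced by an edge between two nonadjacent neighbours, which
lowers the sum by exactly 4; afterwards $u$ is restored by subdividing an edge that misses the book.

For the lower bounds, both spine ends of a book have degree at least 4, while a wheel sequence has
at most one such term. On six vertices no 4-regular graph has a book. -/

namespace SimpleGraph

variable {V : Type*}

open Classical in
/-- The degree of a vertex, as a sum of adjacency indicators. -/
noncomputable def vdeg [Fintype V] (G : SimpleGraph V) (v : V) : ℕ :=
  ∑ w, if G.Adj v w then 1 else 0

/-- Two adjacent vertices `a`, `b` with three common neighbours `x`, `y`, `z`. -/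
structure IsBook (G : SimpleGraph V) (a b x y z : V) : Prop where
  ab : G.Adj a b
  ax : G.Adj a x
  ay : G.Adj a y
  az : G.Adj a z
  bx : G.Adj b x
  b_y : G.Adj b y
  bz : G.Adj b z
  xy : x ≠ y
  xz : x ≠ z
  yz : y ≠ z

/-- `G` contains a book with three triangular pages. -/
def HasBook (G : SimpleGraph V) : Prop := ∃ a b x y z, G.IsBook a b x y z

/-! ### Books and copies of $K_{3,1,1}$ -/

section K311

lemma HasBook.k311_isContained {G : SimpleGraph V} (h : G.HasBook) : K311.IsContained G := by
  obtain ⟨a, b, x, y, z, h⟩ := h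
  let f : (Σ i : Fin 3, Fin (![3, 1, 1] i)) → V := fun p =>
    match p with
    | ⟨0, j⟩ => ![x, y, z] j
    | ⟨1, _⟩ => a
    | ⟨2, _⟩ => b
  have hf : ∀ p q, K311.Adj p q → G.Adj (f p) (f q) := by
    rintro ⟨i, j⟩ ⟨i', j'⟩ hpq
    have hne : i ≠ i' := hpq
    fin_cases i <;> fin_cases i' <;> (try exact absurd rfl hne) <;>
      first
        | exact h.ab
        | exact h.ab.symm
        | (change Fin 3 at j
           fin_cases j
           exacts [h.ax.symm, h.ay.symm, h.az.symm])
        | (change Fin 3 at j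
           fin_cases j
           exacts [h.bx.symm, h.b_y.symm, h.bz.symm])
        | (change Fin 3 at j'
           fin_cases j'
           exacts [h.ax, h.ay, h.az])
        | (change Fin 3 at j'
           fin_cases j'
           exacts [h.bx, h.b_y, h.bz])
  have hinj : Function.Injective f := by
    rintro ⟨i, j⟩ ⟨i', j'⟩ hpq
    by_cases hne : i = i'
    · subst hne
      fin_cases i
      · change Fin 3 at j j'
        have hpq' : ![x, y, z] j = ![x, y, z] j' := hpq
        have := h.xy
        have := h.xz
        have := h.yz
        fin_cases j <;> fin_cases j' <;> simp_all
      · change Fin 1 at j j'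
        rw [Subsingleton.elim j j']
      · change Fin 1 at j j'
        rw [Subsingleton.elim j j']
    · exact absurd hpq (hf ⟨i, j⟩ ⟨i', j'⟩ hne).ne
  exact ⟨Hom.toCopy ⟨f, fun {p q} => hf p q⟩ hinj⟩

lemma hasBook_of_k311_isContained {G : SimpleGraph V} (h : K311.IsContained G) : G.HasBook := by
  obtain ⟨f⟩ := h
  have key : ∀ p q : (Σ i : Fin 3, Fin (![3, 1, 1] i)), p.1 ≠ q.1 → G.Adj (f p) (f q) :=
    fun p q hpq => f.toHom.map_adj hpq
  have hinj : ∀ j j' : Fin 3, j ≠ j' → f ⟨0, j⟩ ≠ f ⟨0, j'⟩ := by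
    intro j j' hj he
    exact hj (eq_of_heq (Sigma.mk.inj_iff.1 (f.injective he)).2)
  refine ⟨f ⟨1, (0 : Fin 1)⟩, f ⟨2, (0 : Fin 1)⟩, f ⟨0, (0 : Fin 3)⟩, f ⟨0, (1 : Fin 3)⟩,
    f ⟨0, (2 : Fin 3)⟩, ?_, ?_, ?_, ?_, ?_, ?_, ?_, ?_, ?_, ?_⟩
  all_goals first | (apply key; simp) | (apply hinj; decide)

end K311

/-! ### Switches, subdivisions, and removing or restoring a star -/

section Operations

variable {G H : SimpleGraph V}

/-- The two-edge switch replacing `ab`, `cd` by `ac`, `bd`. -/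
def switch (G : SimpleGraph V) (a b c d : V) : SimpleGraph V :=
  ((G \ edge a b) \ edge c d) ⊔ edge a c ⊔ edge b d

lemma switch_adj {a b c d v w : V} : (G.switch a b c d).Adj v w ↔
    (((G.Adj v w ∧ ¬ (v = a ∧ w = b ∨ v = b ∧ w = a)) ∧ ¬ (v = c ∧ w = d ∨ v = d ∧ w = c)) ∨
      (v = a ∧ w = c ∨ v = c ∧ w = a) ∧ v ≠ w) ∨ (v = b ∧ w = d ∨ v = d ∧ w = b) ∧ v ≠ w := by
  simp only [switch, sup_adj, sdiff_adj, edge_adj]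
  have : G.Adj v w → v ≠ w := fun h => h.ne
  grind

/-- Subdivide the edge `wq` by `u`. -/
def subdiv (G : SimpleGraph V) (w q u : V) : SimpleGraph V :=
  (G \ edge w q) ⊔ edge u w ⊔ edge u q

lemma subdiv_adj {w q u v v' : V} (huw : u ≠ w) (huq : u ≠ q) : (G.subdiv w q u).Adj v v' ↔
    ((G.Adj v v' ∧ ¬ (v = w ∧ v' = q ∨ v = q ∧ v' = w)) ∨
      (v = u ∧ v' = w ∨ v = w ∧ v' = u)) ∨ (v = u ∧ v' = q ∨ v = q ∧ v' = u) := by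
  simp only [subdiv, sup_adj, sdiff_adj, edge_adj]
  have : G.Adj v v' → v ≠ v' := fun h => h.ne
  grind

/-- Remove all edges at `u`. -/
def isolate (G : SimpleGraph V) (u : V) : SimpleGraph V where
  Adj a b := G.Adj a b ∧ a ≠ u ∧ b ≠ u
  symm := ⟨fun _ _ h => ⟨h.1.symm, h.2.2, h.2.1⟩⟩
  loopless := ⟨fun _ h => h.1.ne rfl⟩

/-- Add to `H` all edges of `G` at `u`. -/
def supStar (H G : SimpleGraph V) (u : V) : SimpleGraph V where
  Adj a b := H.Adj a b ∨ (G.Adj a b ∧ (a = u ∨ b = u))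
  symm := ⟨fun _ _ h => h.imp (·.symm) fun h => ⟨h.1.symm, h.2.symm⟩⟩
  loopless := ⟨fun _ h => h.elim (·.ne rfl) fun h => h.1.ne rfl⟩

lemma IsBook.mono {a b x y z : V} (hGH : G ≤ H) (h : G.IsBook a b x y z) :
    H.IsBook a b x y z :=
  ⟨hGH h.ab, hGH h.ax, hGH h.ay, hGH h.az, hGH h.bx, hGH h.b_y, hGH h.bz, h.xy, h.xz, h.yz⟩

lemma HasBook.mono (hGH : G ≤ H) : G.HasBook → H.HasBook :=
  fun ⟨a, b, x, y, z, h⟩ => ⟨a, b, x, y, z, h.mono hGH⟩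

lemma le_supStar (u : V) : H ≤ H.supStar G u := fun _ _ h => Or.inl h

end Operations

/-! ### Effect of these operations on degrees -/

section Degree

variable [Fintype V] {G H : SimpleGraph V}

lemma vdeg_eq_card [DecidableRel G.Adj] (v : V) :
    G.vdeg v = (Finset.univ.filter fun w => G.Adj v w).card := by
  rw [Finset.card_filter]
  exact Finset.sum_congr rfl fun w _ => by congr

lemma vdeg_eq_degree (v : V) [Fintype (G.neighborSet v)] : G.vdeg v = G.degree v := by
  classical
  rw [vdeg_eq_card, ← card_neighborFinset_eq_degree]
  congr 1
  ext w
  simp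

lemma vdeg_eq_ncard (v : V) : G.vdeg v = (G.neighborSet v).ncard := by
  classical
  rw [vdeg_eq_card, Set.ncard_eq_toFinset_card']
  congr 1
  ext w
  simp

lemma even_sum_vdeg (G : SimpleGraph V) : Even (∑ v, G.vdeg v) := by
  classical
  have : ∑ v, G.vdeg v = ∑ v, G.degree v := Finset.sum_congr rfl fun v _ => vdeg_eq_degree v
  rw [this, sum_degrees_eq_twice_card_edges]
  exact even_two_mul _

lemma vdeg_eq_zero_iff {v : V} : G.vdeg v = 0 ↔ ∀ w, ¬ G.Adj v w := by
  simp [vdeg]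

lemma Adj.vdeg_pos {v w : V} (h : G.Adj v w) : 0 < G.vdeg v := by
  rw [Nat.pos_iff_ne_zero, Ne, vdeg_eq_zero_iff]
  exact fun h' => h' w h

/-- A vertex has a neighbour outside every set smaller than its degree. -/
lemma exists_adj_notMem [DecidableEq V] {v : V} {s : Finset V} (h : s.card < G.vdeg v) :
    ∃ w, G.Adj v w ∧ w ∉ s := by
  classical
  rw [vdeg_eq_card] at h
  obtain ⟨w, hw, hws⟩ := Finset.exists_mem_notMem_of_card_lt_card h
  exact ⟨w, by simpa using hw, hws⟩

lemma vdeg_le_card {v : V} {s : Finset V} (h : ∀ w, G.Adj v w → w ∈ s) : G.vdeg v ≤ s.card := by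
  classical
  by_contra! hlt
  obtain ⟨w, hw, hws⟩ := exists_adj_notMem hlt
  exact hws (h w hw)

lemma adj_of_card_le_vdeg {v : V} {s : Finset V} (h : ∀ w, G.Adj v w → w ∈ s)
    (hs : s.card ≤ G.vdeg v) {w : V} (hw : w ∈ s) : G.Adj v w := by
  classical
  rw [vdeg_eq_card] at hs
  have := Finset.eq_of_subset_of_card_le (s := Finset.univ.filter fun w => G.Adj v w) (t := s)
    (fun w hw => h w (by simpa using hw)) hs
  rw [← this] at hw
  simpa using hw

lemma mem_of_vdeg_le_card {v : V} {s : Finset V} (h : ∀ w ∈ s, G.Adj v w)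
    (hs : G.vdeg v ≤ s.card) {w : V} (hw : G.Adj v w) : w ∈ s := by
  classical
  rw [vdeg_eq_card] at hs
  have := Finset.eq_of_subset_of_card_le (t := Finset.univ.filter fun w => G.Adj v w) (s := s)
    (fun w hw => by simpa using h w hw) hs
  rw [this]
  simpa using hw

open Classical in
lemma vdeg_sup_edge {a b : V} (hne : a ≠ b) (h : ¬ G.Adj a b) (v : V) :
    (G ⊔ edge a b).vdeg v = G.vdeg v + ((if v = a then 1 else 0) + if v = b then 1 else 0) := by
  have h' : ¬ G.Adj b a := fun hh => h hh.symm
  refine (Finset.sum_congr rfl fun w _ => (?_ : _ = (if G.Adj v w then 1 else 0) +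
      ((if w = b then (if v = a then 1 else 0) else 0) +
        if w = a then (if v = b then 1 else 0) else 0))).trans ?_
  · simp only [sup_adj, edge_adj]
    grind
  · simp [Finset.sum_add_distrib, vdeg]

open Classical in
lemma vdeg_sdiff_edge {a b : V} (h : G.Adj a b) (v : V) :
    (G \ edge a b).vdeg v + ((if v = a then 1 else 0) + if v = b then 1 else 0) = G.vdeg v := by
  have hne := h.ne
  rw [← vdeg_sup_edge hne (by simp [edge_adj, hne])]
  congr 1
  ext v w
  simp only [sup_adj, sdiff_adj, edge_adj]
  have := h.symm
  grind

lemma vdeg_switch {a b c d : V} (hab : G.Adj a b) (hcd : G.Adj c d) (hac : ¬ G.Adj a c)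
    (hbd : ¬ G.Adj b d) (hac' : a ≠ c) (hbd' : b ≠ d) : (G.switch a b c d).vdeg = G.vdeg := by
  classical
  have hdb : ¬ G.Adj d b := fun h => hbd h.symm
  have hca : ¬ G.Adj c a := fun h => hac h.symm
  have hab' := hab.ne
  have hcd' := hcd.ne
  have had : a ≠ d := by rintro rfl; exact hca hcd
  funext v
  have h1 := vdeg_sdiff_edge hab v
  have h2 := vdeg_sdiff_edge (G := G \ edge a b) (a := c) (b := d)
    (by simp [edge_adj, hcd, hac'.symm, had.symm]) v
  have h3 := vdeg_sup_edge (G := (G \ edge a b) \ edge c d) hac' (by simp [hac]) v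
  have h4 := vdeg_sup_edge (G := (G \ edge a b) \ edge c d ⊔ edge a c) hbd'
    (by simp [edge_adj, hbd, hab'.symm, had.symm]) v
  rw [switch]
  linarith

open Classical in
lemma vdeg_subdiv {w q u : V} (h : G.Adj w q) (huw : ¬ G.Adj u w) (huq : ¬ G.Adj u q)
    (huw' : u ≠ w) (huq' : u ≠ q) (v : V) :
    (G.subdiv w q u).vdeg v = G.vdeg v + if v = u then 2 else 0 := by
  have hne := h.ne
  have h1 := vdeg_sdiff_edge h v
  have h2 := vdeg_sup_edge (G := G \ edge w q) huw'
    (by simp only [sdiff_adj, edge_adj]; grind) v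
  have h3 := vdeg_sup_edge (G := G \ edge w q ⊔ edge u w) huq'
    (by simp only [sup_adj, sdiff_adj, edge_adj]; grind) v
  rw [subdiv]
  grind

lemma vdeg_isolate_self (u : V) : (G.isolate u).vdeg u = 0 := by
  rw [vdeg_eq_zero_iff]
  exact fun w h => h.2.1 rfl

open Classical in
lemma vdeg_isolate {u v : V} (h : v ≠ u) :
    (G.isolate u).vdeg v + (if G.Adj v u then 1 else 0) = G.vdeg v := by
  symm
  refine (Finset.sum_congr rfl fun w _ => (?_ : _ = (if (G.isolate u).Adj v w then 1 else 0) +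
      if w = u then (if G.Adj v u then 1 else 0) else 0)).trans ?_
  · simp only [isolate]
    grind
  · simp [Finset.sum_add_distrib, vdeg]

/-- The hypothesis forces `u` to be isolated in `H`, so adding its star restores exactly the degrees
lost in `G.isolate u`. This carries a rearrangement of the remainder back to the whole graph. -/
lemma vdeg_supStar {u : V} (h : H.vdeg = (G.isolate u).vdeg) :
    (H.supStar G u).vdeg = G.vdeg := by
  classical
  have hu : ∀ w, ¬ H.Adj u w := by
    rw [← vdeg_eq_zero_iff, h, vdeg_isolate_self]
  have hu' : ∀ w, ¬ H.Adj w u := fun w hw => hu w hw.symm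
  funext v
  by_cases hv : v = u
  · subst hv
    simp only [vdeg, supStar]
    refine Finset.sum_congr rfl fun w _ => ?_
    simp [hu]
  · rw [← vdeg_isolate (G := G) hv, ← h]
    refine (Finset.sum_congr rfl fun w _ => (?_ : _ = (if H.Adj v w then 1 else 0) +
        if w = u then (if G.Adj v u then 1 else 0) else 0)).trans ?_
    · simp only [supStar]
      grind
    · simp [Finset.sum_add_distrib, vdeg]

lemma sum_vdeg_isolate (G : SimpleGraph V) (u : V) :
    ∑ v, (G.isolate u).vdeg v + 2 * G.vdeg u = ∑ v, G.vdeg v := by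
  classical
  have : ∀ v, G.vdeg v = (G.isolate u).vdeg v + ((if G.Adj u v then 1 else 0) +
      if v = u then G.vdeg u else 0) := by
    intro v
    by_cases hv : v = u
    · subst hv
      simp [vdeg_isolate_self]
    · rw [← vdeg_isolate hv]
      simp [hv, adj_comm]
  rw [Finset.sum_congr rfl fun v _ => this v]
  simp only [Finset.sum_add_distrib, Finset.sum_ite_eq', Finset.mem_univ, if_true]
  have h2 : ∑ x, (if G.Adj u x then 1 else 0) = G.vdeg u := rfl
  omega

/-- A vertex adjacent to all other vertices of the support and a second vertex of degree at least
four lie in a book. -/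
lemma hasBook_of_forall_adj {a b : V} (hab : a ≠ b) (hb : 4 ≤ G.vdeg b)
    (h : ∀ v, v ≠ a → 0 < G.vdeg v → G.Adj a v) : G.HasBook := by
  classical
  obtain ⟨x, hx, hxs⟩ := exists_adj_notMem (G := G) (v := b) (s := {a}) (by simp; omega)
  obtain ⟨y, hy, hys⟩ := exists_adj_notMem (G := G) (v := b) (s := {a, x})
    (Finset.card_le_two.trans_lt (by omega))
  obtain ⟨z, hz, hzs⟩ := exists_adj_notMem (G := G) (v := b) (s := {a, x, y})
    (Finset.card_le_three.trans_lt (by omega))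
  simp only [Finset.mem_insert, Finset.mem_singleton, not_or] at hxs hys hzs
  exact ⟨a, b, x, y, z, h b hab.symm (by omega), h x hxs hx.symm.vdeg_pos,
    h y hys.1 hy.symm.vdeg_pos, h z hzs.1 hz.symm.vdeg_pos, hx, hy, hz,
    Ne.symm hys.2, Ne.symm hzs.2.1, Ne.symm hzs.2.2⟩

end Degree

/-! ### Explicit graphs containing books -/

section Enumeration

variable {V : Type*} [Fintype V] {G H : SimpleGraph V}

/-- The graph on `Fin n` with a given list of edges. -/
def ofEdgeList (n : ℕ) (l : List (ℕ × ℕ)) : SimpleGraph (Fin n) where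
  Adj i j := i ≠ j ∧ ((i.val, j.val) ∈ l ∨ (j.val, i.val) ∈ l)
  symm := ⟨fun _ _ h => ⟨h.1.symm, h.2.symm⟩⟩
  loopless := ⟨fun _ h => h.1 rfl⟩

instance (n : ℕ) (l : List (ℕ × ℕ)) : DecidableRel (ofEdgeList n l).Adj :=
  fun i j => inferInstanceAs (Decidable (i ≠ j ∧ ((i.val, j.val) ∈ l ∨ (j.val, i.val) ∈ l)))

lemma vdeg_map {W : Type*} [Fintype W] (D : SimpleGraph W) (f : W ↪ V) (i : W) :
    (D.map f).vdeg (f i) = D.vdeg i := by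
  rw [vdeg_eq_ncard, vdeg_eq_ncard, ← Set.ncard_image_of_injective _ f.injective]
  congr 1
  ext v
  simp only [mem_neighborSet, map_adj, Set.mem_image]
  constructor
  · rintro ⟨a, b, hab, ha, rfl⟩
    rw [f.injective ha] at hab
    exact ⟨b, hab, rfl⟩
  · rintro ⟨b, hb, rfl⟩
    exact ⟨i, b, hb, rfl, rfl⟩

/-- Moves a concrete graph on `Fin n`, where degrees and adjacencies are decidable, onto the support
of `d` inside an arbitrary `V`. -/
lemma exists_hasBook_of_embedding {n : ℕ} (l : List (ℕ × ℕ)) (d : V → ℕ) (f : Fin n ↪ V)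
    (hd : ∀ i, (ofEdgeList n l).degree i = d (f i)) (h0 : ∀ v ∉ Finset.univ.map f, d v = 0)
    (hb : (ofEdgeList n l).HasBook) : ∃ H : SimpleGraph V, H.vdeg = d ∧ H.HasBook := by
  refine ⟨(ofEdgeList n l).map f, ?_, ?_⟩
  · funext v
    by_cases hv : v ∈ Finset.univ.map f
    · obtain ⟨i, -, rfl⟩ := Finset.mem_map.1 hv
      rw [vdeg_map, vdeg_eq_degree, hd]
    · rw [h0 v hv, vdeg_eq_zero_iff]
      rintro w ⟨-, a, b, -, rfl, -⟩
      exact hv (by simp)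
  · obtain ⟨a, b, x, y, z, h⟩ := hb
    have key : ∀ i j, (ofEdgeList n l).Adj i j → ((ofEdgeList n l).map f).Adj (f i) (f j) :=
      fun i j hij => (map_adj_apply).2 hij
    exact ⟨f a, f b, f x, f y, f z, key _ _ h.ab, key _ _ h.ax, key _ _ h.ay, key _ _ h.az,
      key _ _ h.bx, key _ _ h.b_y, key _ _ h.bz, f.injective.ne h.xy, f.injective.ne h.xz,
      f.injective.ne h.yz⟩

omit [Fintype V] in
lemma exists_monotone_enum (d : V → ℕ) {n : ℕ} {S : Finset V} (hS : S.card = n) :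
    ∃ f : Fin n ↪ V, Finset.univ.map f = S ∧ Monotone (d ∘ f) := by
  classical
  let e : Fin n ≃ S := (S.equivFinOfCardEq hS).symm
  let g : Fin n → ℕ := fun i => d (e i)
  refine ⟨((Tuple.sort g).trans e).toEmbedding.trans (Function.Embedding.subtype _), ?_,
    Tuple.monotone_sort g⟩
  apply Finset.eq_of_subset_of_card_le
  · intro v hv
    obtain ⟨i, -, rfl⟩ := Finset.mem_map.1 hv
    exact (e (Tuple.sort g i)).2
  · simp [hS]

lemma sum_enum {d : V → ℕ} {n : ℕ} {S : Finset V} (f : Fin n ↪ V) (hf : Finset.univ.map f = S)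
    (h0 : ∀ v ∉ S, d v = 0) : ∑ v, d v = ∑ i, d (f i) := by
  rw [← Finset.sum_subset (Finset.subset_univ S) fun v _ hv => h0 v hv, ← hf, Finset.sum_map]

/-- The degree sequence `(4, 4, 4, 4, 3, 3)`. -/
lemma exists_hasBook_six {d : V → ℕ} {S : Finset V} (hS : S.card = 6) (h0 : ∀ v ∉ S, d v = 0)
    (h3 : ∀ v ∈ S, 3 ≤ d v) (h4 : ∀ v ∈ S, d v ≤ 4) (hsum : ∑ v, d v = 22) :
    ∃ H : SimpleGraph V, H.vdeg = d ∧ H.HasBook := by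
  obtain ⟨f, hf, hmono⟩ := exists_monotone_enum d hS
  have hm : ∀ i, f i ∈ S := fun i => by rw [← hf]; simp
  rw [sum_enum f hf h0] at hsum
  simp only [Fin.sum_univ_succ, Fin.sum_univ_zero] at hsum
  simp only [Fin.reduceSucc] at hsum
  have h01 : d (f 0) ≤ d (f 1) := hmono (by decide)
  have h12 : d (f 1) ≤ d (f 2) := hmono (by decide)
  have h23 : d (f 2) ≤ d (f 3) := hmono (by decide)
  have h34 : d (f 3) ≤ d (f 4) := hmono (by decide)
  have h45 : d (f 4) ≤ d (f 5) := hmono (by decide)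
  have l := fun i => h3 (f i) (hm i)
  have r := fun i => h4 (f i) (hm i)
  have l0 := l 0
  have r5 := r 5
  refine exists_hasBook_of_embedding
    [(0, 1), (0, 2), (0, 3), (1, 4), (1, 5), (2, 3), (2, 4), (2, 5), (3, 4), (3, 5), (4, 5)] d f
    ?_ (by rwa [hf]) ⟨2, 3, 0, 4, 5, by constructor <;> decide⟩
  have hdeg : ∀ i, (ofEdgeList 6 [(0, 1), (0, 2), (0, 3), (1, 4), (1, 5), (2, 3), (2, 4), (2, 5),
    (3, 4), (3, 5), (4, 5)]).degree i = ![3, 3, 4, 4, 4, 4] i := by decide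
  intro i
  rw [hdeg]
  fin_cases i <;> simp <;> omega

/-- The degree sequences of seven terms between three and five with sum `26`. -/
lemma exists_hasBook_seven {d : V → ℕ} {S : Finset V} (hS : S.card = 7) (h0 : ∀ v ∉ S, d v = 0)
    (h3 : ∀ v ∈ S, 3 ≤ d v) (h5 : ∀ v ∈ S, d v ≤ 5) (hsum : ∑ v, d v = 26) :
    ∃ H : SimpleGraph V, H.vdeg = d ∧ H.HasBook := by
  obtain ⟨f, hf, hmono⟩ := exists_monotone_enum d hS
  have hm : ∀ i, f i ∈ S := fun i => by rw [← hf]; simp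
  rw [sum_enum f hf h0] at hsum
  simp only [Fin.sum_univ_succ, Fin.sum_univ_zero] at hsum
  simp only [Fin.reduceSucc] at hsum
  have h01 : d (f 0) ≤ d (f 1) := hmono (by decide)
  have h12 : d (f 1) ≤ d (f 2) := hmono (by decide)
  have h23 : d (f 2) ≤ d (f 3) := hmono (by decide)
  have h34 : d (f 3) ≤ d (f 4) := hmono (by decide)
  have h45 : d (f 4) ≤ d (f 5) := hmono (by decide)
  have h56 : d (f 5) ≤ d (f 6) := hmono (by decide)
  have l0 := h3 (f 0) (hm 0)
  have r6 := h5 (f 6) (hm 6)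
  rw [← hf] at h0
  -- The excesses over 3 are at most 2 and sum to 5, hence are 1+1+1+1+1, 2+2+1 or 2+1+1+1.
  by_cases c6 : d (f 6) = 4
  · have hdeg : ∀ i, (ofEdgeList 7 [(0, 1), (0, 2), (0, 3), (1, 2), (1, 4), (2, 5), (2, 6), (3, 4),
      (3, 5), (3, 6), (4, 5), (4, 6), (5, 6)]).degree i = ![3, 3, 4, 4, 4, 4, 4] i := by decide
    refine exists_hasBook_of_embedding _ d f (fun i => (hdeg i).trans ?_) h0
      ⟨5, 6, 2, 3, 4, by constructor <;> decide⟩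
    fin_cases i <;> simp <;> omega
  by_cases c5 : d (f 5) = 5
  · have hdeg : ∀ i, (ofEdgeList 7 [(0, 1), (0, 2), (0, 4), (1, 5), (1, 6), (2, 5), (2, 6), (3, 4),
      (3, 5), (3, 6), (4, 5), (4, 6), (5, 6)]).degree i = ![3, 3, 3, 3, 4, 5, 5] i := by decide
    refine exists_hasBook_of_embedding _ d f (fun i => (hdeg i).trans ?_) h0
      ⟨5, 6, 1, 2, 3, by constructor <;> decide⟩
    fin_cases i <;> simp <;> omega
  · have hdeg : ∀ i, (ofEdgeList 7 [(0, 1), (0, 2), (0, 3), (1, 4), (1, 6), (2, 5), (2, 6), (3, 4),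
      (3, 5), (3, 6), (4, 5), (4, 6), (5, 6)]).degree i = ![3, 3, 3, 4, 4, 4, 5] i := by decide
    refine exists_hasBook_of_embedding _ d f (fun i => (hdeg i).trans ?_) h0
      ⟨4, 6, 1, 3, 5, by constructor <;> decide⟩
    fin_cases i <;> simp <;> omega

omit [Fintype V] in
-- The only edge lost is `wq`, and its end `w` lies outside the book.
lemma IsBook.subdiv {a b x y z w q u : V} (h : G.IsBook a b x y z)
    (hw : w ≠ a ∧ w ≠ b ∧ w ≠ x ∧ w ≠ y ∧ w ≠ z) (huw : u ≠ w) (huq : u ≠ q) :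
    (G.subdiv w q u).IsBook a b x y z := by
  have key : ∀ v v', w ≠ v → w ≠ v' → G.Adj v v' → (G.subdiv w q u).Adj v v' := by
    intro v v' hv hv' hvv
    rw [subdiv_adj huw huq]
    grind
  obtain ⟨ha, hb, hx, hy, hz⟩ := hw
  exact ⟨key _ _ ha hb h.ab, key _ _ ha hx h.ax, key _ _ ha hy h.ay, key _ _ ha hz h.az,
    key _ _ hb hx h.bx, key _ _ hb hy h.b_y, key _ _ hb hz h.bz, h.xy, h.xz, h.yz⟩

open Classical in
/-- There are 4-regular graphs with a book on every set of at least seven vertices. -/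
lemma exists_regular_four_hasBook (S : Finset V) (hS : 7 ≤ S.card) :
    ∃ H : SimpleGraph V, (H.vdeg = fun v => if v ∈ S then 4 else 0) ∧ H.HasBook := by
  obtain ⟨n, hn⟩ : ∃ n, S.card = n := ⟨_, rfl⟩
  rw [hn] at hS
  induction n, hS using Nat.le_induction generalizing S with
  | base =>
    obtain ⟨f, hf, -⟩ := exists_monotone_enum (fun _ : V => 0) hn
    have hdeg : ∀ i, (ofEdgeList 7 [(0, 1), (0, 2), (0, 3), (0, 4), (1, 2), (1, 3), (1, 4), (2, 5),
      (2, 6), (3, 5), (3, 6), (4, 5), (4, 6), (5, 6)]).degree i = 4 := by decide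
    refine exists_hasBook_of_embedding _ _ f (fun i => (hdeg i).trans ?_) ?_
      ⟨0, 1, 2, 3, 4, by constructor <;> decide⟩
    · rw [if_pos]
      rw [← hf]
      simp
    · intro v hv
      rw [hf] at hv
      exact if_neg hv
  | succ n hn7 ih =>
    -- Subdividing two edges with four distinct ends by the same new vertex `u` gives `u` degree 4
    -- and changes no other degree. Each edge has an end, `w` or `w'`, off the book; at least seven
    -- old vertices leave room for both.
    obtain ⟨u, hu⟩ : S.Nonempty := Finset.card_pos.1 (by omega)
    have hT : (S.erase u).card = n := by rw [Finset.card_erase_of_mem hu]; omega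
    obtain ⟨H, hH, a, b, x, y, z, hB⟩ := ih _ hT
    have hdeg : ∀ v, H.vdeg v = if v ∈ S.erase u then 4 else 0 := fun v => congrFun hH v
    have hu0 : ∀ v, ¬ H.Adj u v := by
      rw [← vdeg_eq_zero_iff, hdeg]
      simp
    have hne : ∀ v v', H.Adj v v' → u ≠ v ∧ u ≠ v' :=
      fun v v' h => ⟨by rintro rfl; exact hu0 _ h, by rintro rfl; exact hu0 _ h.symm⟩
    obtain ⟨w, hwT, hw⟩ := Finset.exists_mem_notMem_of_card_lt_card
      (s := {a, b, x, y, z}) (t := S.erase u) (Finset.card_le_five.trans_lt (by omega))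
    obtain ⟨w', hwT', hw'⟩ := Finset.exists_mem_notMem_of_card_lt_card
      (s := {a, b, x, y, z, w}) (t := S.erase u) (Finset.card_le_six.trans_lt (by omega))
    obtain ⟨q, hq, hqs⟩ := exists_adj_notMem (G := H) (v := w) (s := {w'})
      (by rw [hdeg, if_pos hwT]; simp)
    obtain ⟨q', hq', hqs'⟩ := exists_adj_notMem (G := H) (v := w') (s := {w, q})
      (Finset.card_le_two.trans_lt (by rw [hdeg, if_pos hwT']; simp))
    simp only [Finset.mem_insert, Finset.mem_singleton, not_or] at hw hw' hqs hqs'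
    obtain ⟨huw, huq⟩ := hne _ _ hq
    obtain ⟨huw', huq'⟩ := hne _ _ hq'
    refine ⟨(H.subdiv w q u).subdiv w' q' u, ?_, a, b, x, y, z,
      (hB.subdiv hw huw huq).subdiv ⟨hw'.1, hw'.2.1, hw'.2.2.1, hw'.2.2.2.1, hw'.2.2.2.2.1⟩
        huw' huq'⟩
    funext v
    rw [vdeg_subdiv _ _ _ huw' huq', vdeg_subdiv hq (hu0 _) (hu0 _) huw huq, hdeg]
    · by_cases hv : v = u
      · simp [hv, hu]
      · simp [hv]
    · rw [subdiv_adj huw huq]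
      grind
    · rw [subdiv_adj huw huq]
      grind
    · rw [subdiv_adj huw huq]
      grind

end Enumeration

/-! ### The induction on the order -/

section Main

variable {V : Type*} [Fintype V] {G H : SimpleGraph V}

/-- The vertex `a` is adjacent to all the rest of `S`. The other degrees sum to at least $3|S|-1 >
3(|S|-1)$, so one of them is at least 4. -/
lemma hasBook_of_le_sum {S : Finset V} (h0 : ∀ v ∉ S, G.vdeg v = 0) {a : V} (ha : a ∈ S)
    (hda : S.card - 1 ≤ G.vdeg a) (hS : 5 ≤ S.card) (hsum : 4 * S.card - 2 ≤ ∑ v, G.vdeg v) :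
    G.HasBook := by
  classical
  have hsub : ∀ w, G.Adj a w → w ∈ S.erase a := fun w hw =>
    Finset.mem_erase.2 ⟨hw.ne', by_contra fun h => hw.symm.vdeg_pos.ne' (h0 w h)⟩
  have hcard : (S.erase a).card = S.card - 1 := Finset.card_erase_of_mem ha
  have hle := vdeg_le_card hsub
  have hsum' : ∑ v ∈ S, G.vdeg v = ∑ v, G.vdeg v :=
    Finset.sum_subset (Finset.subset_univ S) fun v _ hv => h0 v hv
  rw [← Finset.add_sum_erase S _ ha] at hsum'
  have : ∃ b ∈ S.erase a, 4 ≤ G.vdeg b := by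
    by_contra! hcon
    have := Finset.sum_le_card_nsmul (S.erase a) G.vdeg 3 fun v hv => by
      have := hcon v hv
      omega
    rw [smul_eq_mul] at this
    have h2 : ∑ x ∈ S.erase a, G.vdeg x = (S.erase a).sum G.vdeg := rfl
    omega
  obtain ⟨b, hb, hb4⟩ := this
  refine hasBook_of_forall_adj (a := a) (b := b) (Finset.ne_of_mem_erase hb).symm hb4 ?_
  intro v hva hv
  refine adj_of_card_le_vdeg hsub (hcard.trans_le hda) (Finset.mem_erase.2 ⟨hva, ?_⟩)
  by_contra h
  exact hv.ne' (h0 v h)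

lemma card_le_vdeg {v : V} {s : Finset V} (h : ∀ w ∈ s, G.Adj v w) : s.card ≤ G.vdeg v := by
  classical
  rw [vdeg_eq_card]
  exact Finset.card_le_card fun w hw => by simpa using h w hw

/-- A graph obtained from a 4-regular graph on six vertices by adding a vertex `u`. -/
lemma exists_hasBook_of_isolate_regular {T : Finset V} (hT : T.card = 6) {u : V} (hu : u ∉ T)
    (h0 : ∀ v ∉ T, v ≠ u → G.vdeg v = 0) (h4 : ∀ v ∈ T, (G.isolate u).vdeg v = 4)
    (hpos : 0 < G.vdeg u) (hlt : G.vdeg u ≤ 4) :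
    ∃ H : SimpleGraph V, H.vdeg = G.vdeg ∧ H.HasBook := by
  classical
  have hmem : ∀ v w, G.Adj v w → w ≠ u → w ∈ T := fun v w hvw hw =>
    by_contra fun h => hvw.symm.vdeg_pos.ne' (h0 w h hw)
  have hTu : ∀ v ∈ T, v ≠ u := by rintro v hv rfl; exact hu hv
  obtain ⟨x, hux⟩ : ∃ x, G.Adj u x := by
    by_contra! h
    exact hpos.ne' (vdeg_eq_zero_iff.2 h)
  have hxT : x ∈ T := hmem u x hux hux.ne'
  have hTx : (T.erase x).card = 5 := by rw [Finset.card_erase_of_mem hxT, hT]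
  -- `x'` is the antipode of `x` in the octahedron: the two are nonadjacent and share the other four
  -- vertices as neighbours.
  obtain ⟨x', hx'T, hxx'⟩ : ∃ x' ∈ T.erase x, ¬ G.Adj x x' := by
    by_contra! h
    have := card_le_vdeg (G := G.isolate u) (v := x) (s := T.erase x) fun w hw =>
      ⟨h w hw, hux.ne', hTu _ (Finset.mem_of_mem_erase hw)⟩
    rw [h4 x hxT, hTx] at this
    omega
  obtain ⟨hx'x, hx'T⟩ := Finset.mem_erase.1 hx'T
  have hadj : ∀ c c', c ∈ T → c' ∈ T → c ≠ c' → ¬ G.Adj c c' → ∀ v ∈ T, v ≠ c → v ≠ c' →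
      G.Adj c v := by
    intro c c' hc hc' hcc' hnadj v hv hvc hvc'
    have hcard : ((T.erase c).erase c').card = 4 := by
      rw [Finset.card_erase_of_mem (Finset.mem_erase.2 ⟨hcc'.symm, hc'⟩),
        Finset.card_erase_of_mem hc, hT]
    refine (adj_of_card_le_vdeg (G := G.isolate u) (v := c) (s := (T.erase c).erase c') ?_
      (by rw [hcard, h4 c hc]) (by simp [hv, hvc, hvc'])).1
    intro w hw
    have h1 : w ≠ c' := by rintro rfl; exact hnadj hw.1
    simp [h1, hw.1.ne', hmem _ _ hw.1 hw.2.2]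
  have hx := hadj x x' hxT hx'T hx'x.symm hxx'
  have hx' := hadj x' x hx'T hxT hx'x fun h => hxx' h.symm
  obtain ⟨y, hyT, hyx', huy⟩ : ∃ y ∈ T, y ≠ x' ∧ ¬ G.Adj u y := by
    by_contra! h
    have := card_le_vdeg (G := G) (v := u) (s := T.erase x') fun w hw =>
      h w (Finset.mem_of_mem_erase hw) (Finset.ne_of_mem_erase hw)
    rw [Finset.card_erase_of_mem hx'T, hT] at this
    omega
  have hyx : y ≠ x := by rintro rfl; exact huy hux
  have hcard : (((T.erase x).erase x').erase y).card = 3 := by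
    rw [Finset.card_erase_of_mem, Finset.card_erase_of_mem, hTx] <;> simp [*]
  obtain ⟨p, q, r, hpq, hpr, hqr, hset⟩ := Finset.card_eq_three.1 hcard
  have hpage : ∀ v, v = p ∨ v = q ∨ v = r → v ≠ y ∧ v ≠ x' ∧ v ≠ x ∧ v ∈ T := by
    intro v hv
    have : v ∈ ((T.erase x).erase x').erase y := by rw [hset]; simpa using hv
    simpa using this
  -- Exchanging `ux`, `yx'` for `uy`, `xx'` makes the antipodes adjacent. They lose only `y` as a
  -- common neighbour, so three pages remain.
  have hsw := vdeg_switch hux (hx' y hyT hyx' hyx).symm huy hxx' (hTu y hyT).symm hx'x.symm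
  have hxu := hux.ne'
  have hx'u := hTu x' hx'T
  have key : ∀ v, v = p ∨ v = q ∨ v = r →
      (G.switch u x y x').Adj x v ∧ (G.switch u x y x').Adj x' v := by
    intro v hv
    obtain ⟨h1, h2, h3, h4⟩ := hpage v hv
    have h5 := hx v h4 h3 h2
    have h6 := hx' v h4 h2 h3
    have h7 := hTu v h4
    rw [switch_adj, switch_adj]
    grind
  refine ⟨G.switch u x y x', hsw, x, x', p, q, r, ?_, (key p (by simp)).1, (key q (by simp)).1,
    (key r (by simp)).1, (key p (by simp)).2, (key q (by simp)).2, (key r (by simp)).2, hpq, hpr,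
    hqr⟩
  rw [switch_adj]
  grind

/-- A vertex of degree three in a `K₄` can be given two nonadjacent neighbours by a switch along
an edge outside the `K₄`. -/
lemma exists_not_adj_of_edge {u x y z p q : V} (hux : G.Adj u x) (huy : G.Adj u y)
    (huz : G.Adj u z) (hxy : G.Adj x y) (hxz : G.Adj x z) (hyz : G.Adj y z) (hpq : G.Adj p q)
    (hup : ¬ G.Adj u p) (hpu : p ≠ u) (hqx : q ≠ x) (hqy : q ≠ y) (hqz : q ≠ z)
    (hxq : ¬ G.Adj x q) :
    ∃ H : SimpleGraph V, H.vdeg = G.vdeg ∧ (H.HasBook ∨ ∃ x y z, H.Adj u x ∧ H.Adj u y ∧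
      H.Adj u z ∧ x ≠ y ∧ x ≠ z ∧ y ≠ z ∧ ¬ H.Adj x y) := by
  have hpx : p ≠ x := by rintro rfl; exact hup hux
  have hpy : p ≠ y := by rintro rfl; exact hup huy
  have hpz : p ≠ z := by rintro rfl; exact hup huz
  -- If `p` sees both `y` and `z`, the spine `yz` has pages `u`, `x`, `p`. Otherwise, after the
  -- switch `u` has neighbours `p`, `y`, `z`, and `p` misses `y` or `z`.
  by_cases hbook : G.Adj y p ∧ G.Adj z p
  · exact ⟨G, rfl, Or.inl ⟨y, z, u, x, p, hyz, huy.symm, hxy.symm, hbook.1, huz.symm, hxz.symm,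
      hbook.2, hux.ne, hpu.symm, hpx.symm⟩⟩
  refine ⟨G.switch u x p q, vdeg_switch hux hpq hup hxq hpu.symm hqx.symm, Or.inr ?_⟩
  have h1 : (G.switch u x p q).Adj u p := by rw [switch_adj]; grind
  have h2 : (G.switch u x p q).Adj u y := by have := hxy.ne; rw [switch_adj]; grind
  have h3 : (G.switch u x p q).Adj u z := by have := hxz.ne; rw [switch_adj]; grind
  have hyu := huy.ne
  have hzu := huz.ne
  have hxy' := hxy.ne
  have hxz' := hxz.ne
  have hpq' := hpq.ne
  by_cases hyp : G.Adj y p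
  · refine ⟨p, z, y, h1, h3, h2, hpz, hpy, hyz.ne', ?_⟩
    have : ¬ G.Adj p z := fun h => hbook ⟨hyp, h.symm⟩
    rw [switch_adj]
    grind
  · refine ⟨p, y, z, h1, h2, h3, hpy, hpz, hyz.ne, ?_⟩
    have : ¬ G.Adj p y := fun h => hyp h.symm
    rw [switch_adj]
    grind

/-- Only the case of a triangle `xyz` needs work. A further vertex adjacent to all of `x`, `y`, `z`
gives a book with spine `xy`. Otherwise a vertex `p` outside the $K_4$ has, by its degree, a
neighbour `q` outside `{x, y, z}`, and if `q` misses one of these three, `exists_not_adj_of_edge`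
applies there. -/
lemma exists_not_adj_of_vdeg_eq_three {S : Finset V} (hS : 5 ≤ S.card)
    (h3 : ∀ v ∈ S, 3 ≤ G.vdeg v) {u : V} (hu : G.vdeg u = 3) :
    ∃ H : SimpleGraph V, H.vdeg = G.vdeg ∧ (H.HasBook ∨ ∃ x y z, H.Adj u x ∧ H.Adj u y ∧
      H.Adj u z ∧ x ≠ y ∧ x ≠ z ∧ y ≠ z ∧ ¬ H.Adj x y) := by
  classical
  have hcard := hu
  rw [vdeg_eq_card] at hcard
  obtain ⟨x, y, z, hxy, hxz, hyz, hset⟩ := Finset.card_eq_three.1 hcard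
  have hN : ∀ v, G.Adj u v ↔ v = x ∨ v = y ∨ v = z := by
    intro v
    have : v ∈ (Finset.univ.filter fun w => G.Adj u w) ↔ v ∈ ({x, y, z} : Finset V) := by
      rw [hset]
    simpa using this
  have hux : G.Adj u x := (hN x).2 (by simp)
  have huy : G.Adj u y := (hN y).2 (by simp)
  have huz : G.Adj u z := (hN z).2 (by simp)
  by_cases axy : G.Adj x y
  swap
  · exact ⟨G, rfl, Or.inr ⟨x, y, z, hux, huy, huz, hxy, hxz, hyz, axy⟩⟩
  by_cases axz : G.Adj x z
  swap
  · exact ⟨G, rfl, Or.inr ⟨x, z, y, hux, huz, huy, hxz, hxy, hyz.symm, axz⟩⟩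
  by_cases ayz : G.Adj y z
  swap
  · exact ⟨G, rfl, Or.inr ⟨y, z, x, huy, huz, hux, hyz, hxy.symm, hxz.symm, ayz⟩⟩
  have hbook : ∀ p, p ≠ u → G.Adj x p → G.Adj y p → G.Adj z p → G.HasBook :=
    fun p hpu hx hy hz => ⟨x, y, u, z, p, axy, hux.symm, axz, hx, huy.symm, ayz, hy,
      huz.ne, hpu.symm, hz.ne⟩
  obtain ⟨p, hpS, hp⟩ := Finset.exists_mem_notMem_of_card_lt_card
    (s := {u, x, y, z}) (t := S) (Finset.card_le_four.trans_lt (by omega))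
  simp only [Finset.mem_insert, Finset.mem_singleton, not_or] at hp
  obtain ⟨hpu, hpx, hpy, hpz⟩ := hp
  by_cases hall : G.Adj x p ∧ G.Adj y p ∧ G.Adj z p
  · exact ⟨G, rfl, Or.inl (hbook p hpu hall.1 hall.2.1 hall.2.2)⟩
  have hup : ¬ G.Adj u p := by rw [hN]; tauto
  obtain ⟨q, hpq, hq⟩ : ∃ q, G.Adj p q ∧ q ∉ ({x, y, z} : Finset V) := by
    by_contra! h
    have hle : ({x, y, z} : Finset V).card ≤ G.vdeg p := Finset.card_le_three.trans (h3 p hpS)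
    have hadj := fun w hw => adj_of_card_le_vdeg (w := w) h hle hw
    exact hall ⟨(hadj x (by simp)).symm, (hadj y (by simp)).symm, (hadj z (by simp)).symm⟩
  simp only [Finset.mem_insert, Finset.mem_singleton, not_or] at hq
  obtain ⟨hqx, hqy, hqz⟩ := hq
  have hqu : q ≠ u := by rintro rfl; exact hup hpq.symm
  by_cases hxq : G.Adj x q
  swap
  · exact exists_not_adj_of_edge hux huy huz axy axz ayz hpq hup hpu hqx hqy hqz hxq
  by_cases hyq : G.Adj y q
  swap
  · exact exists_not_adj_of_edge huy hux huz axy.symm ayz axz hpq hup hpu hqy hqx hqz hyq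
  by_cases hzq : G.Adj z q
  swap
  · exact exists_not_adj_of_edge huz hux huy axz.symm ayz.symm axy hpq hup hpu hqz hqx hqy hzq
  · exact ⟨G, rfl, Or.inl (hbook q hqu hxq hyq hzq)⟩

open Classical in
/-- Degrees after replacing a vertex `u` with neighbours `x`, `y`, `z` by the edge `xy`. -/
lemma vdeg_isolate_sup_edge {u x y z : V} (hu : G.vdeg u = 3) (hux : G.Adj u x) (huy : G.Adj u y)
    (huz : G.Adj u z) (hxy : x ≠ y) (hxz : x ≠ z) (hyz : y ≠ z) (hnadj : ¬ G.Adj x y) (v : V) :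
    (G.isolate u ⊔ edge x y).vdeg v + ((if v = z then 1 else 0) + if v = u then 3 else 0) =
      G.vdeg v := by
  have hN : ∀ v, G.Adj v u ↔ v = x ∨ v = y ∨ v = z := by
    intro v
    constructor
    · intro h
      have := mem_of_vdeg_le_card (G := G) (v := u) (s := {x, y, z}) (by simp [hux, huy, huz])
        (by rw [hu, Finset.card_eq_three.2 ⟨x, y, z, hxy, hxz, hyz, rfl⟩]) h.symm
      simpa using this
    · rintro (rfl | rfl | rfl)
      exacts [hux.symm, huy.symm, huz.symm]
  rw [vdeg_sup_edge hxy fun h : (G.isolate u).Adj x y => hnadj h.1]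
  have hxu := hux.ne
  have hyu := huy.ne
  have hzu := huz.ne
  by_cases hvu : v = u
  · subst hvu
    rw [vdeg_isolate_self]
    simp [hxu, hyu, hzu, hu]
  · rw [← vdeg_isolate (G := G) hvu]
    simp only [hN]
    grind

/-- Undo the replacement of a vertex of degree three by an edge, preserving a book. -/
lemma exists_hasBook_of_isolate_sup_edge {S : Finset V} (hS : 8 ≤ S.card)
    (h3 : ∀ v ∈ S, 3 ≤ G.vdeg v) {u x y z : V} (hu : G.vdeg u = 3) (hux : G.Adj u x)
    (huy : G.Adj u y) (huz : G.Adj u z) (hxy : x ≠ y) (hxz : x ≠ z) (hyz : y ≠ z)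
    (hnadj : ¬ G.Adj x y) (hH : H.vdeg = (G.isolate u ⊔ edge x y).vdeg) (hB : H.HasBook) :
    ∃ H : SimpleGraph V, H.vdeg = G.vdeg ∧ H.HasBook := by
  classical
  have hdeg := vdeg_isolate_sup_edge hu hux huy huz hxy hxz hyz hnadj
  rw [← hH] at hdeg
  have hzu := huz.ne'
  have hu0 : ∀ v, ¬ H.Adj u v := by
    rw [← vdeg_eq_zero_iff]
    have := hdeg u
    simp only [if_true] at this
    omega
  obtain ⟨a, b, c, c', c'', hB⟩ := hB
  -- Seven vertices are to be avoided, hence the bound 8. Since `w` is neither `u` nor `z`, its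
  -- degree in `H` is still at least 3.
  obtain ⟨w, hwS, hw⟩ := Finset.exists_mem_notMem_of_card_lt_card
    (s := insert u {a, b, c, c', c'', z}) (t := S)
    ((Finset.card_insert_le _ _).trans_lt
      ((Nat.succ_le_succ Finset.card_le_six).trans_lt (by omega)))
  simp only [Finset.mem_insert, Finset.mem_singleton, not_or] at hw
  obtain ⟨hwu, hwa, hwb, hwc, hwc', hwc'', hwz⟩ := hw
  have hdw := hdeg w
  rw [if_neg hwz, if_neg hwu] at hdw
  have hw3 := h3 w hwS
  -- With `q` different from `z`, the subdivision does not use the edge `uz`, which is added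
  -- afterwards.
  obtain ⟨q, hwq, hqz⟩ := exists_adj_notMem (G := H) (v := w) (s := {z}) (by simp; omega)
  rw [Finset.mem_singleton] at hqz
  have hqu : q ≠ u := by rintro rfl; exact hu0 _ hwq.symm
  have hnz : ¬ (H.subdiv w q u).Adj u z := by
    rw [subdiv_adj (Ne.symm hwu) hqu.symm]
    have := hu0 z
    grind
  refine ⟨H.subdiv w q u ⊔ edge u z, ?_, HasBook.mono le_sup_left ⟨a, b, c, c', c'',
    hB.subdiv ⟨hwa, hwb, hwc, hwc', hwc''⟩ (Ne.symm hwu) hqu.symm⟩⟩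
  funext v
  rw [vdeg_sup_edge hzu.symm hnz, vdeg_subdiv hwq (hu0 _) (hu0 _) (Ne.symm hwu) hqu.symm, ← hdeg v]
  grind

/-- Every graph with all edges inside `S` and degree sum at least `4 * |S| - 2` can be replaced by
one with the same degrees that contains a book, unless it is 4-regular on six vertices. -/
theorem exists_vdeg_eq_hasBook (G : SimpleGraph V) (S : Finset V) (h0 : ∀ v ∉ S, G.vdeg v = 0)
    (hS : 5 ≤ S.card) (hsum : 4 * S.card - 2 ≤ ∑ v, G.vdeg v)
    (hex : S.card = 6 → ∃ v ∈ S, G.vdeg v ≠ 4) :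
    ∃ H : SimpleGraph V, H.vdeg = G.vdeg ∧ H.HasBook := by
  classical
  obtain ⟨n, hn⟩ : ∃ n, S.card = n := ⟨_, rfl⟩
  have hS' := hS
  rw [hn] at hS'
  induction n, hS' using Nat.le_induction generalizing S G with
  | base =>
    have hsum' : ∑ v ∈ S, G.vdeg v = ∑ v, G.vdeg v :=
      Finset.sum_subset (Finset.subset_univ S) fun v _ hv => h0 v hv
    have : ∃ a ∈ S, 4 ≤ G.vdeg a := by
      by_contra! hcon
      have := Finset.sum_le_card_nsmul S (fun v => G.vdeg v) 3 fun v hv => by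
        have := hcon v hv
        omega
      rw [smul_eq_mul] at this
      omega
    obtain ⟨a, ha, ha4⟩ := this
    exact ⟨G, rfl, hasBook_of_le_sum h0 ha (by omega) hS hsum⟩
  | succ n hn5 ih =>
    have hsum' : ∑ v ∈ S, G.vdeg v = ∑ v, G.vdeg v :=
      Finset.sum_subset (Finset.subset_univ S) fun v _ hv => h0 v hv
    obtain ⟨u, hu, hmin⟩ := Finset.exists_min_image S G.vdeg (Finset.card_pos.1 (by omega))
    have hT : (S.erase u).card = n := by rw [Finset.card_erase_of_mem hu]; omega
    have hlow : S.card * G.vdeg u ≤ ∑ v, G.vdeg v := by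
      rw [← hsum', ← smul_eq_mul]
      exact Finset.card_nsmul_le_sum S (fun v => G.vdeg v) _ hmin
    have hiso0 : ∀ v ∉ S.erase u, (G.isolate u).vdeg v = 0 := by
      intro v hv
      by_cases hvu : v = u
      · rw [hvu, vdeg_isolate_self]
      · have := vdeg_isolate (G := G) hvu
        rw [h0 v fun h => hv (Finset.mem_erase.2 ⟨hvu, h⟩)] at this
        omega
    have hisum := sum_vdeg_isolate G u
    by_cases hdel : 4 * n - 2 + 2 * G.vdeg u ≤ ∑ v, G.vdeg v
    · by_cases hreg : n = 6 ∧ ∀ v ∈ S.erase u, (G.isolate u).vdeg v = 4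
      · obtain ⟨rfl, hreg⟩ := hreg
        have hi24 : ∑ v, (G.isolate u).vdeg v = 24 := by
          rw [← Finset.sum_subset (Finset.subset_univ (S.erase u)) fun v _ hv => hiso0 v hv,
            Finset.sum_congr rfl hreg, Finset.sum_const, hT]
          rfl
        -- The total is $24 + 2d(u)$: being at least 26 it gives $d(u) \ge 1$, and minimality,
        -- $7d(u) \le 24 + 2d(u)$, gives $d(u) \le 4$.
        refine exists_hasBook_of_isolate_regular hT (Finset.notMem_erase u S)
          (fun v hv hvu => h0 v fun h => hv (Finset.mem_erase.2 ⟨hvu, h⟩)) hreg (by omega) ?_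
        rw [hn] at hlow
        omega
      · obtain ⟨H, hH, hB⟩ := ih (G.isolate u) (S.erase u) hiso0 (by omega) (by omega)
          (fun h => by
            by_contra! hcon
            exact hreg ⟨by omega, hcon⟩) hT
        exact ⟨H.supStar G u, vdeg_supStar hH, hB.mono (le_supStar u)⟩
    · obtain ⟨m, hm⟩ := G.even_sum_vdeg
      have hlt : G.vdeg u ≤ 4 := by
        by_contra! h
        rw [hn] at hlow
        obtain ⟨k, rfl⟩ := Nat.exists_eq_add_of_le hn5
        obtain ⟨j, hj⟩ := Nat.exists_eq_add_of_le h
        rw [hj] at hlow hdel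
        have : ∑ v, G.vdeg v + 3 ≤ 4 * (5 + k) + 2 * (4 + 1 + j) := by omega
        nlinarith [Nat.zero_le (k * j)]
      by_cases hfull : ∃ a ∈ S, S.card - 1 ≤ G.vdeg a
      · obtain ⟨a, ha, hda⟩ := hfull
        exact ⟨G, rfl, hasBook_of_le_sum h0 ha hda hS hsum⟩
      push Not at hfull
      -- Failure of `hdel` together with the sum being at least $4n+2$ forces $d(u) \ge 3$.
      obtain h3 | h4 : G.vdeg u = 3 ∨ G.vdeg u = 4 := by omega
      · have hmin3 : ∀ v ∈ S, 3 ≤ G.vdeg v := fun v hv => h3.symm.trans_le (hmin v hv)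
        -- By parity the sum is exactly $4n+2$, and `hfull` bounds every degree by $n-1$.
        obtain h6 | h7 | h8 : n + 1 = 6 ∨ n + 1 = 7 ∨ 8 ≤ n + 1 := by omega
        · exact exists_hasBook_six (by omega) h0 hmin3
            (fun v hv => by have := hfull v hv; omega) (by omega)
        · exact exists_hasBook_seven (by omega) h0 hmin3
            (fun v hv => by have := hfull v hv; omega) (by omega)
        · obtain ⟨G', hG', hB | ⟨x, y, z, hux, huy, huz, hxy, hxz, hyz, hnadj⟩⟩ :=
            exists_not_adj_of_vdeg_eq_three hS hmin3 h3
          · exact ⟨G', hG', hB⟩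
          · rw [← hG'] at h0 hmin3 h3 hsum ⊢
            have hdeg := vdeg_isolate_sup_edge h3 hux huy huz hxy hxz hyz hnadj
            have hdsum : ∑ v, (G'.isolate u ⊔ edge x y).vdeg v + 4 = ∑ v, G'.vdeg v := by
              rw [← Finset.sum_congr rfl fun v _ => hdeg v]
              simp [Finset.sum_add_distrib]
            obtain ⟨H, hH, hB⟩ := ih (G'.isolate u ⊔ edge x y) (S.erase u)
              (fun v hv => by
                have := hdeg v
                by_cases hvu : v = u
                · subst hvu
                  simp only [if_true] at this
                  omega
                · rw [h0 v fun h => hv (Finset.mem_erase.2 ⟨hvu, h⟩)] at this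
                  omega)
              (by omega) (by omega) (by omega) hT
            exact exists_hasBook_of_isolate_sup_edge (by omega) hmin3 h3 hux huy huz hxy hxz hyz
              hnadj hH hB
      · have hall : ∀ v ∈ S, 4 = G.vdeg v := by
          refine (Finset.sum_eq_sum_iff_of_le fun v hv => h4.symm.trans_le (hmin v hv)).1 ?_
          rw [Finset.sum_const, smul_eq_mul, hsum']
          rw [h4] at hlow hdel
          omega
        obtain h6 | h7 : S.card = 6 ∨ 7 ≤ S.card := by omega
        · obtain ⟨v, hv, hv4⟩ := hex h6
          exact absurd (hall v hv).symm hv4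
        · obtain ⟨H, hH, hB⟩ := exists_regular_four_hasBook S h7
          refine ⟨H, hH.trans ?_, hB⟩
          funext v
          split_ifs with hv
          exacts [hall v hv, (h0 v hv).symm]

end Main

/-! ### Wheels and 4-regular graphs on six vertices -/

lemma isRealization_iff_vdeg {n : ℕ} {G : SimpleGraph (Fin n)} {d : Fin n → ℕ} :
    IsRealization G d ↔ G.vdeg = d := by
  simp only [IsRealization, funext_iff, vdeg_eq_ncard]

/-- The wheel with hub `0` and `m` spokes. -/
def wheel (m : ℕ) : SimpleGraph (Fin (m + 1)) where
  Adj i j := i ≠ j ∧ (i = 0 ∨ j = 0 ∨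
    ∃ a b, i = Fin.succ a ∧ j = Fin.succ b ∧ (cycleGraph m).Adj a b)
  symm := ⟨fun _ _ ⟨h, h'⟩ => ⟨h.symm, h'.elim (fun h => Or.inr (Or.inl h)) fun h' =>
    h'.imp id fun ⟨a, b, ha, hb, hab⟩ => Or.inr ⟨b, a, hb, ha, hab.symm⟩⟩⟩
  loopless := ⟨fun _ h => h.1 rfl⟩

lemma vdeg_wheel_zero (m : ℕ) : (wheel m).vdeg 0 = m := by
  have h0 : ∀ i : Fin m, (0 : Fin (m + 1)) ≠ i.succ := fun i => (Fin.succ_ne_zero i).symm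
  simp [vdeg, Fin.sum_univ_succ, wheel, h0]

lemma vdeg_wheel_succ {m : ℕ} (hm : 3 ≤ m) (i : Fin m) : (wheel m).vdeg i.succ = 3 := by
  classical
  obtain ⟨k, rfl⟩ := Nat.exists_eq_add_of_le' hm
  have h2 : (cycleGraph (k + 3)).vdeg i = 2 := by
    rw [vdeg_eq_degree, cycleGraph_degree_three_le]
  have h : ∀ j : Fin (k + 3), (wheel (k + 3)).Adj i.succ j.succ ↔ (cycleGraph (k + 3)).Adj i j := by
    intro j
    simp only [wheel, Fin.succ_ne_zero, false_or, ne_eq, Fin.succ_inj]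
    constructor
    · rintro ⟨-, a, b, rfl, rfl, hab⟩
      exact hab
    · exact fun hij => ⟨hij.ne, i, j, rfl, rfl, hij⟩
  have h0 : (wheel (k + 3)).Adj i.succ 0 := by simp [wheel]
  rw [vdeg] at h2 ⊢
  rw [Fin.sum_univ_succ]
  simp only [h, h0, if_true]
  refine Eq.trans ?_ (congrArg (1 + ·) h2)
  congr!

lemma HasBook.exists_four_le_vdeg {V : Type*} [Fintype V] {G : SimpleGraph V} (h : G.HasBook) :
    ∃ a b, a ≠ b ∧ 4 ≤ G.vdeg a ∧ 4 ≤ G.vdeg b := by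
  classical
  obtain ⟨a, b, x, y, z, h⟩ := h
  have hx := h.bx.ne
  have hy := h.b_y.ne
  have hz := h.bz.ne
  have hx' := h.ax.ne
  have hy' := h.ay.ne
  have hz' := h.az.ne
  have h1 : ({b, x, y, z} : Finset V).card = 4 := by
    rw [Finset.card_insert_of_notMem (by simp [*]),
      Finset.card_eq_three.2 ⟨x, y, z, h.xy, h.xz, h.yz, rfl⟩]
  have h2 : ({a, x, y, z} : Finset V).card = 4 := by
    rw [Finset.card_insert_of_notMem (by simp [*]),
      Finset.card_eq_three.2 ⟨x, y, z, h.xy, h.xz, h.yz, rfl⟩]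
  refine ⟨a, b, h.ab.ne, ?_, ?_⟩
  · rw [← h1]
    exact card_le_vdeg (by simp [h.ab, h.ax, h.ay, h.az])
  · rw [← h2]
    exact card_le_vdeg (by simp [h.ab.symm, h.bx, h.b_y, h.bz])

/-- A graph of order six all of whose degrees are four contains no book. -/
lemma not_hasBook_of_regular_four {G : SimpleGraph (Fin 6)} (hG : G.vdeg = fun _ => 4) :
    ¬ G.HasBook := by
  rintro ⟨a, b, x, y, z, h⟩
  have hxy := h.xy
  have hxz := h.xz
  have hyz := h.yz
  have hxyz : ({x, y, z} : Finset (Fin 6)).card = 3 :=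
    Finset.card_eq_three.2 ⟨x, y, z, hxy, hxz, hyz, rfl⟩
  have hcard : ∀ c, c ≠ x → c ≠ y → c ≠ z → (insert c {x, y, z} : Finset (Fin 6)).card = 4 := by
    intro c hx hy hz
    rw [Finset.card_insert_of_notMem (by simp [*]), hxyz]
  have hNa : ∀ w, G.Adj a w → w ∈ (insert b {x, y, z} : Finset (Fin 6)) := fun w hw =>
    mem_of_vdeg_le_card (G := G) (by simp [h.ab, h.ax, h.ay, h.az])
      (by rw [hcard b h.bx.ne h.b_y.ne h.bz.ne, hG]) hw
  have hNb : ∀ w, G.Adj b w → w ∈ (insert a {x, y, z} : Finset (Fin 6)) := fun w hw =>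
    mem_of_vdeg_le_card (G := G) (by simp [h.ab.symm, h.bx, h.b_y, h.bz])
      (by rw [hcard a h.ax.ne h.ay.ne h.az.ne, hG]) hw
  obtain ⟨w, -, hw⟩ := Finset.exists_mem_notMem_of_card_lt_card
    (s := {a, b, x, y, z}) (t := (Finset.univ : Finset (Fin 6)))
    (Finset.card_le_five.trans_lt (by simp))
  simp only [Finset.mem_insert, Finset.mem_singleton, not_or] at hw hNa hNb
  -- The spine ends already have all four neighbours within the book, so the sixth vertex `w` can
  -- only see the three pages and has degree at most 3.
  have := vdeg_le_card (G := G) (v := w) (s := {x, y, z}) fun v hv => by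
    have hva : v ≠ a := by
      rintro rfl
      have := hNa w hv.symm
      tauto
    have hvb : v ≠ b := by
      rintro rfl
      have := hNb w hv.symm
      tauto
    by_contra hv3
    simp only [Finset.mem_insert, Finset.mem_singleton, not_or] at hv3
    have hwv := hv.ne
    have h6 : ({a, b, x, y, z, w, v} : Finset (Fin 6)).card ≤ 6 := Finset.card_le_univ _
    have hab := h.ab.ne
    have hax := h.ax.ne
    have hay := h.ay.ne
    have haz := h.az.ne
    have hbx := h.bx.ne
    have hby := h.b_y.ne
    have hbz := h.bz.ne
    have h7 : ({a, b, x, y, z, w, v} : Finset (Fin 6)).card = 7 := by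
      repeat rw [Finset.card_insert_of_notMem (by simp; grind)]
      simp
    omega
  rw [hxyz, hG] at this
  norm_num at this

/-! ### Graphic sequences and the values of `sigma` -/

lemma hasRealizationContaining_of_le_sum {n : ℕ} (hn : 5 ≤ n) {d : Fin n → ℕ} (hd : IsGraphic d)
    (hsum : 4 * n - 2 ≤ ∑ i, d i) (hex : n = 6 → ∃ i, d i ≠ 4) :
    HasRealizationContaining K311 d := by
  obtain ⟨-, G, hG⟩ := hd
  rw [isRealization_iff_vdeg] at hG
  subst hG
  obtain ⟨H, hH, hB⟩ := exists_vdeg_eq_hasBook G Finset.univ (by simp) (by simpa using hn)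
    (by simpa using hsum) (by simpa using hex)
  exact ⟨H, isRealization_iff_vdeg.2 hH, hB.k311_isContained⟩

lemma not_hasRealizationContaining_of_regular_four :
    ¬ HasRealizationContaining K311 (fun _ : Fin 6 => 4) := by
  rintro ⟨H, hH, hK⟩
  exact not_hasBook_of_regular_four (isRealization_iff_vdeg.1 hH) (hasBook_of_k311_isContained hK)

lemma isGraphic_regular_four : IsGraphic (fun _ : Fin 6 => 4) := by
  refine ⟨antitone_const, ofEdgeList 6 [(0, 2), (0, 3), (0, 4), (0, 5), (1, 2), (1, 3), (1, 4),
    (1, 5), (2, 4), (2, 5), (3, 4), (3, 5)], isRealization_iff_vdeg.2 ?_⟩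
  have : ∀ i, (ofEdgeList 6 [(0, 2), (0, 3), (0, 4), (0, 5), (1, 2), (1, 3), (1, 4),
    (1, 5), (2, 4), (2, 5), (3, 4), (3, 5)]).degree i = 4 := by decide
  funext i
  rw [vdeg_eq_degree, this]

/-- The degree sequence of the wheel. -/
def wheelSeq (m : ℕ) : Fin (m + 1) → ℕ := Fin.cons m fun _ => 3

lemma vdeg_wheel {m : ℕ} (hm : 3 ≤ m) : (wheel m).vdeg = wheelSeq m := by
  funext i
  refine Fin.cases ?_ (fun j => ?_) i
  · rw [vdeg_wheel_zero, wheelSeq, Fin.cons_zero]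
  · rw [vdeg_wheel_succ hm, wheelSeq, Fin.cons_succ]

lemma isGraphic_wheelSeq {m : ℕ} (hm : 3 ≤ m) : IsGraphic (wheelSeq m) := by
  refine ⟨fun i j hij => ?_, wheel m, isRealization_iff_vdeg.2 (vdeg_wheel hm)⟩
  induction i using Fin.cases with
  | zero => induction j using Fin.cases <;> simp [wheelSeq, hm]
  | succ i =>
    induction j using Fin.cases with
    | zero => exact absurd hij (by simp)
    | succ j => simp [wheelSeq]

lemma not_hasRealizationContaining_wheelSeq (m : ℕ) :
    ¬ HasRealizationContaining K311 (wheelSeq m) := by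
  rintro ⟨H, hH, hK⟩
  obtain ⟨a, b, hab, ha, hb⟩ := (hasBook_of_k311_isContained hK).exists_four_le_vdeg
  rw [isRealization_iff_vdeg.1 hH] at ha hb
  induction a using Fin.cases with
  | zero =>
    induction b using Fin.cases with
    | zero => exact hab rfl
    | succ b => simp [wheelSeq] at hb
  | succ a => simp [wheelSeq] at ha

lemma sum_wheelSeq (m : ℕ) : ∑ i, wheelSeq m i = 4 * m := by
  simp [wheelSeq, Fin.sum_univ_succ]
  omega

lemma sigma_k311 {n : ℕ} (hn : n = 5 ∨ 7 ≤ n) : sigma K311 n = 4 * n - 2 := by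
  refine (sigma_isLeast K311 n).unique ⟨⟨⟨2 * n - 1, by omega⟩, fun d hd _ hsum =>
    hasRealizationContaining_of_le_sum (by omega) hd hsum (by omega)⟩, ?_⟩
  rintro l ⟨⟨k, hk⟩, hl⟩
  -- An even `l` below $4n-2$ is at most $4n-4$, the sum of the wheel sequence with $n-1$ spokes.
  by_contra! hlt
  obtain ⟨m, rfl⟩ : ∃ m, n = m + 1 := ⟨n - 1, by omega⟩
  refine not_hasRealizationContaining_wheelSeq m (hl _ (isGraphic_wheelSeq (by omega)) ?_ ?_)
  · intro i
    induction i using Fin.cases with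
    | zero => rw [wheelSeq, Fin.cons_zero]; omega
    | succ i => simp [wheelSeq]
  · rw [sum_wheelSeq]
    omega

lemma hasRealizationContaining_or_eq_four {d : Fin 6 → ℕ} (hd : IsGraphic d)
    (hsum : 22 ≤ ∑ i, d i) : HasRealizationContaining K311 d ∨ d = fun _ => 4 := by
  by_cases h : d = fun _ => 4
  · exact Or.inr h
  · refine Or.inl (hasRealizationContaining_of_le_sum (by norm_num) hd hsum fun _ => ?_)
    by_contra! hcon
    exact h (funext hcon)

lemma sigma_k311_six : sigma K311 6 = 26 := by
  refine (sigma_isLeast K311 6).unique ⟨⟨by decide, fun d hd _ hsum => ?_⟩, ?_⟩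
  · refine (hasRealizationContaining_or_eq_four hd (by omega)).resolve_right ?_
    rintro rfl
    simp at hsum
  · rintro l ⟨⟨k, hk⟩, hl⟩
    -- An even `l` below 26 is at most 24, the sum of the 4-regular sequence.
    by_contra! hlt
    refine not_hasRealizationContaining_of_regular_four (hl _ isGraphic_regular_four (by simp) ?_)
    simp
    omega

end SimpleGraph

theorem theorem4p4 :
    (∀ n : ℕ, n = 5 ∨ 7 ≤ n → sigma K311 n = 4 * n - 2) ∧
    (∀ d : Fin 6 → ℕ, IsGraphic d → 22 ≤ ∑ i, d i →
      HasRealizationContaining K311 d ∨ d = fun _ => 4) ∧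
    sigma K311 6 = 26 :=
  ⟨fun _ hn => SimpleGraph.sigma_k311 hn,
    fun _ hd hsum => SimpleGraph.hasRealizationContaining_or_eq_four hd hsum,
    SimpleGraph.sigma_k311_six⟩
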